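/- Fix an integer $s\ge 1$. For each $n$ let $v^{(n)},x^{(n)}\in\mathbb R^n$, and suppose that there is a constant $M$ such that $|v^{(n)}_i|\le M$ and $|x^{(n)}_i|\le M$ for all $n$ and all $i\in\{1,\dots,n\}$. Stochastic uniform quantization $Q$ is defined as follows. For $w\in\mathbb R^n$, divide the coordinates into buckets of $b_n\ge 1$ consecutive coordinates (the last bucket may be shorter; $b_n\ge n$ means no bucketing). For a coordinate $i$ let $\beta_i$ be the minimum of $w$ over the bucket of $i$, let $\alpha_i$ be the maximum minus the minimum of $w$ over that bucket, let $\hat w_i=(w_i-\beta_i)/\alpha_i\in[0,1]$ (with $\hat w_i=0$ if $\alpha_i=0$), and set $$Q(w_i)=\alpha_i\left(\frac{\lfloor s\hat w_i\rfloor}{s}+\frac{\xi_i}{s}\right)+\beta_i,\qquad \xi_i\sim\mathrm{Bernoulli}\bigl(s\hat w_i-\lfloor s\hat w_i\rfloor\bigr).$$ For each $n$, quantize both $v=v^{(n)}$ and $x=x^{(n)}$ in this way, with all $2n$ rounding variables mutually independent, and let $s_n^2=\sum_{i=1}^n\mathrm{Var}[Q(v_i)Q(x_i)]$. If $s_n\to\infty$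 as $n\to\infty$, then $$\sum_{i=1}^n Q(v_i)Q(x_i)=\sum_{i=1}^n v_ix_i+\varepsilon_n,$$ where $E[\varepsilon_n]=0$ for every $n$, and $$\frac{1}{s_n}\,\varepsilon_n\xrightarrow{\ \mathcal D\ }N(0,1)\qquad(n\to\infty).$$ -/

import Mathlib

open MeasureTheory ProbabilityTheory Filter

noncomputable section

namespace UniformQuantization

/-- The bucket containing coordinate `i`, when the coordinates are divided into buckets of `b`
consecutive ones (the last bucket may be shorter). If `n ≤ b`, or if `b = 0` (since then `k / b = 0`
for all `k`), there is a single bucket, which is quantization without bucketing. -/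
def bucket {n : ℕ} (b : ℕ) (i : Fin n) : Finset (Fin n) :=
  Finset.univ.filter fun j => (j : ℕ) / b = (i : ℕ) / b

theorem bucket_nonempty {n : ℕ} (b : ℕ) (i : Fin n) : (bucket b i).Nonempty :=
  ⟨i, by simp [bucket]⟩

/-- The offset `β`: the smallest entry of `v` in the bucket of `i`. -/
def offset {n : ℕ} (b : ℕ) (v : Fin n → ℝ) (i : Fin n) : ℝ :=
  (bucket b i).inf' (bucket_nonempty b i) v

/-- The scale `α`: the largest minus the smallest entry of `v` in the bucket of `i`. -/
def scale {n : ℕ} (b : ℕ) (v : Fin n → ℝ) (i : Fin n) : ℝ :=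
  (bucket b i).sup' (bucket_nonempty b i) v - (bucket b i).inf' (bucket_nonempty b i) v

/-- The linearly scaled entry `(v i - β) / α`. If `v` is constant on the bucket, then `α = 0` and
this is `0`. -/
def scaled {n : ℕ} (b : ℕ) (v : Fin n → ℝ) (i : Fin n) : ℝ :=
  (v i - offset b v i) / scale b v i

/-- The rounding probability `k = t s - ⌊t s⌋` of a scaled entry `t`. -/
def roundProb (s : ℕ) (t : ℝ) : unitInterval :=
  ⟨t * s - ⌊t * s⌋, sub_nonneg.2 (Int.floor_le _), (Int.fract_lt_one (t * s)).le⟩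

/-- The uniform quantization `⌊t s⌋ / s + ξ / s` of a scaled entry `t`, where `ξ` is the value of
the rounding variable. -/
def uniformQuant (s : ℕ) (t ξ : ℝ) : ℝ :=
  ⌊t * s⌋ / s + ξ / s

/-- The quantization `α * uniformQuant + β` of the `i`-th entry of `v`, where `ξ` is the value of
the rounding variable. If `v` is constant on the bucket, then `α = 0` and this is `v i`. -/
def quantize {n : ℕ} (s b : ℕ) (v : Fin n → ℝ) (i : Fin n) (ξ : ℝ) : ℝ :=
  scale b v i * uniformQuant s (scaled b v i) ξ + offset b v i

/-- `ξ` and `ζ` are the rounding variables of independent stochastic quantizations of the vectors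
`v` and `x`: each is Bernoulli, with value `1` with the rounding probability of its entry and value
`0` otherwise, and all of them are independent. -/
structure IsStochasticRounding {Ω : Type*} [MeasurableSpace Ω] (P : Measure Ω) {n : ℕ} (s b : ℕ)
    (v x : Fin n → ℝ) (ξ ζ : Fin n → Ω → ℝ) : Prop where
  law_left : ∀ i, HasLaw (ξ i) (bernoulliMeasure (1 : ℝ) 0 (roundProb s (scaled b v i))) P
  law_right : ∀ i, HasLaw (ζ i) (bernoulliMeasure (1 : ℝ) 0 (roundProb s (scaled b x i))) P
  indep : iIndepFun (Sum.elim ξ ζ) P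

end UniformQuantization

end

namespace UniformQuantization

/-! Stochastic rounding is unbiased, so by independence `Qv i * Qx i` has mean `v i * x i`. Hence
`ε` is a sum of independent centred terms, and these are bounded by a constant depending only on
`M`, whatever the bucket sizes (`abs_quantize_le`). For such arrays, divergence of the total
variance suffices for a CLT. At frequency `u = t / σ` each characteristic function differs from the
Gaussian one of equal variance by at most `2 * |u| ^ 3 * C * Var` (`norm_charFun_sub_exp_le`).
Factors of norm at most one let these errors add up (`norm_prod_sub_prod_le_sum`); as the variances
sum to `σ ^ 2`, the total is `2 * |t| ^ 3 * C / σ`, which tends to `0`, and Lévy's continuity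
theorem concludes. -/

/-- Applying a measurable function to each pair `(f i, g i)` taken from two families that are
jointly independent gives an independent family. -/
theorem iIndepFun_comp_prodMk {ι Ω : Type*} [Fintype ι] [MeasurableSpace Ω] {P : Measure Ω}
    [IsProbabilityMeasure P] {f g : ι → Ω → ℝ} (hf : ∀ i, AEMeasurable (f i) P)
    (hg : ∀ i, AEMeasurable (g i) P) (h : iIndepFun (Sum.elim f g) P)
    {φ : ι → ℝ × ℝ → ℝ} (hφ : ∀ i, Measurable (φ i)) :
    iIndepFun (fun i ω => φ i (f i ω, g i ω)) P := by
  have hfg : ∀ j, AEMeasurable (Sum.elim f g j) P := by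
    rintro (i | i)
    exacts [hf i, hg i]
  have hpair : ∀ i, P.map (fun ω => (f i ω, g i ω)) = (P.map (f i)).prod (P.map (g i)) := fun i =>
    (indepFun_iff_map_prod_eq_prod_map_map (hf i) (hg i)).1
      (h.indepFun (i := Sum.inl i) (j := Sum.inr i) Sum.inl_ne_inr)
  have hprob : ∀ j, IsProbabilityMeasure (P.map (Sum.elim f g j)) := fun j =>
    Measure.isProbabilityMeasure_map (hfg j)
  have hprobf : ∀ i, IsProbabilityMeasure (P.map (f i)) := fun i => hprob (Sum.inl i)
  have hprobg : ∀ i, IsProbabilityMeasure (P.map (g i)) := fun i => hprob (Sum.inr i)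
  -- Independence means that the joint law is a product measure; regrouping coordinates from `ι ⊕ ι
  -- → ℝ` to `ι → ℝ × ℝ` preserves product measures.
  have hsum := measurePreserving_sumPiEquivProdPi fun j => P.map (Sum.elim f g j)
  have harr := (measurePreserving_arrowProdEquivProdArrow ℝ ℝ ι (fun i => P.map (f i))
    (fun i => P.map (g i))).symm
  have hT := harr.comp hsum
  suffices hp : iIndepFun (fun i ω => (f i ω, g i ω)) P from hp.comp φ hφ
  rw [iIndepFun_iff_map_fun_eq_pi_map fun i => (hf i).prodMk (hg i)]
  simp_rw [hpair]
  rw [← hT.map_eq, ← h.map_fun_eq_pi_map hfg,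
    AEMeasurable.map_map_of_aemeasurable hT.measurable.aemeasurable (aemeasurable_pi_lambda _ hfg)]
  rfl

/-! ### Central limit theorem for bounded triangular arrays -/

/-- Telescoping: replace the factors one at a time; the untouched ones have norm at most one. -/
theorem norm_prod_sub_prod_le_sum {ι : Type*} (s : Finset ι) (a b : ι → ℂ)
    (ha : ∀ i, ‖a i‖ ≤ 1) (hb : ∀ i, ‖b i‖ ≤ 1) :
    ‖∏ i ∈ s, a i - ∏ i ∈ s, b i‖ ≤ ∑ i ∈ s, ‖a i - b i‖ := by
  classical
  induction s using Finset.induction_on with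
  | empty => simp
  | insert i s hi ih =>
    rw [Finset.prod_insert hi, Finset.prod_insert hi, Finset.sum_insert hi]
    have hs : ‖∏ j ∈ s, b j‖ ≤ 1 := by
      rw [norm_prod]
      exact Finset.prod_le_one (fun j _ => norm_nonneg _) fun j _ => hb j
    calc ‖a i * ∏ j ∈ s, a j - b i * ∏ j ∈ s, b j‖
        = ‖(a i - b i) * ∏ j ∈ s, b j + a i * (∏ j ∈ s, a j - ∏ j ∈ s, b j)‖ := by
          congr 1; ring
      _ ≤ ‖a i - b i‖ * ‖∏ j ∈ s, b j‖ + ‖a i‖ * ‖∏ j ∈ s, a j - ∏ j ∈ s, b j‖ := by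
          rw [← norm_mul, ← norm_mul]; exact norm_add_le _ _
      _ ≤ ‖a i - b i‖ * 1 + 1 * ‖∏ j ∈ s, a j - ∏ j ∈ s, b j‖ := by
          gcongr; exact ha i
      _ ≤ ‖a i - b i‖ + ∑ j ∈ s, ‖a j - b j‖ := by linarith

theorem norm_exp_mul_I_sub_le {y : ℝ} (hy : |y| ≤ 1) :
    ‖Complex.exp (y * Complex.I) - (1 + y * Complex.I - (y : ℂ) ^ 2 / 2)‖ ≤ |y| ^ 3 := by
  have hn : ‖(y : ℂ) * Complex.I‖ = |y| := by simp
  have h := Complex.exp_bound (x := y * Complex.I) (by rwa [hn]) (n := 3) (by norm_num)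
  rw [hn] at h
  have he : ∑ m ∈ Finset.range 3, ((y : ℂ) * Complex.I) ^ m / (m.factorial : ℂ)
      = 1 + y * Complex.I - (y : ℂ) ^ 2 / 2 := by
    simp [Finset.sum_range_succ, mul_pow, Nat.factorial]
    ring
  rw [he] at h
  refine h.trans ?_
  have : (0 : ℝ) ≤ |y| ^ 3 := by positivity
  norm_num [Nat.factorial]
  linarith

/-- The characteristic function of a bounded centred random variable is close to that of the
Gaussian with the same variance. -/
theorem norm_charFun_sub_exp_le {Ω : Type*} [MeasurableSpace Ω] {P : Measure Ω}
    [IsProbabilityMeasure P] {X : Ω → ℝ} (hX : AEMeasurable X P) {C : ℝ}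
    (hC : ∀ᵐ ω ∂P, |X ω| ≤ C) (h0 : ∫ ω, X ω ∂P = 0) {u : ℝ} (hu : |u| * C ≤ 1) :
    ‖charFun (P.map X) u - Complex.exp (-(u ^ 2 * variance X P / 2 : ℝ))‖
      ≤ 2 * |u| ^ 3 * C * variance X P := by
  have hC0 : 0 ≤ C := by
    obtain ⟨ω, hω⟩ := hC.exists
    exact (abs_nonneg _).trans hω
  have hLp : MemLp X 2 P := MemLp.of_bound hX.aestronglyMeasurable C hC
  have hint : Integrable X P := hLp.integrable one_le_two
  have hint2 : Integrable (fun ω => X ω ^ 2) P := hLp.integrable_sq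
  set V := variance X P
  have hVint : V = ∫ ω, X ω ^ 2 ∂P := variance_of_integral_eq_zero hX h0
  have hV0 : 0 ≤ V := variance_nonneg _ _
  have hVC : V ≤ C ^ 2 := by
    rw [hVint]
    calc ∫ ω, X ω ^ 2 ∂P ≤ ∫ _, C ^ 2 ∂P := by
          refine integral_mono_ae hint2 (integrable_const _) ?_
          filter_upwards [hC] with ω hω
          exact sq_le_sq' (abs_le.1 hω).1 (abs_le.1 hω).2
      _ = C ^ 2 := by simp
  have hexp : Integrable (fun ω => Complex.exp (u * X ω * Complex.I)) P := by
    refine Integrable.of_bound (C := 1) ?_ (.of_forall fun ω => ?_)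
    · exact (by fun_prop : Measurable fun x : ℝ =>
        Complex.exp (u * x * Complex.I)).comp_aemeasurable hX |>.aestronglyMeasurable
    · rw [← Complex.ofReal_mul, Complex.norm_exp_ofReal_mul_I]
  have htaylor : ‖charFun (P.map X) u - (1 - (u ^ 2 * V / 2 : ℝ))‖ ≤ |u| ^ 3 * C * V := by
    have hq1 : Integrable (fun ω => (X ω : ℂ) * (u * Complex.I)) P := hint.ofReal.mul_const _
    have hq2 : Integrable (fun ω => ((X ω ^ 2 : ℝ) : ℂ) * (u ^ 2 / 2)) P := hint2.ofReal.mul_const _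
    have hc1 : Integrable (fun ω => (1 : ℂ) + (X ω : ℂ) * (u * Complex.I)) P :=
      (integrable_const _).add hq1
    have hq : ∫ ω, ((1 : ℂ) + (X ω : ℂ) * (u * Complex.I) - ((X ω ^ 2 : ℝ) : ℂ) * (u ^ 2 / 2)) ∂P
        = 1 - ((u ^ 2 * V / 2 : ℝ) : ℂ) := by
      rw [integral_sub hc1 hq2, integral_add (integrable_const _) hq1, integral_mul_const,
        integral_mul_const, integral_complex_ofReal, integral_complex_ofReal, h0, ← hVint]
      simp
      ring
    rw [charFun_apply_real, integral_map hX (by fun_prop), ← hq]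
    refine (congrArg norm (integral_sub hexp (hc1.sub hq2))).symm.trans_le ?_
    calc _ ≤ ∫ ω, |u| ^ 3 * C * X ω ^ 2 ∂P := by
          refine norm_integral_le_of_norm_le (hint2.const_mul _) ?_
          filter_upwards [hC] with ω hω
          have hy : |u * X ω| ≤ 1 := by
            rw [abs_mul]
            exact (mul_le_mul_of_nonneg_left hω (abs_nonneg u)).trans hu
          have h := norm_exp_mul_I_sub_le hy
          calc _ = ‖Complex.exp (↑(u * X ω) * Complex.I) -
                (1 + ↑(u * X ω) * Complex.I - (↑(u * X ω) : ℂ) ^ 2 / 2)‖ := by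
                congr 1; simp only [Pi.sub_apply]; push_cast; ring
            _ ≤ |u * X ω| ^ 3 := h
            _ = |u| ^ 3 * |X ω| * X ω ^ 2 := by rw [abs_mul, ← sq_abs (X ω)]; ring
            _ ≤ |u| ^ 3 * C * X ω ^ 2 := by gcongr
      _ = |u| ^ 3 * C * V := by rw [integral_const_mul, ← hVint]
  have hw0 : 0 ≤ u ^ 2 * V / 2 := by positivity
  have huC : (|u| * C) ^ 2 ≤ 1 := pow_le_one₀ (by positivity) hu
  have huV : u ^ 2 * V ≤ (|u| * C) ^ 2 := by
    rw [mul_pow, sq_abs]; gcongr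
  have hgauss : ‖(1 - (u ^ 2 * V / 2 : ℝ) : ℂ) - Complex.exp (-(u ^ 2 * V / 2 : ℝ))‖
      ≤ |u| ^ 3 * C * V := by
    have h := Real.abs_exp_sub_one_sub_id_le (x := -(u ^ 2 * V / 2))
      (by rw [abs_neg, abs_of_nonneg hw0]; linarith)
    have he : (1 - (u ^ 2 * V / 2 : ℝ) : ℂ) - Complex.exp (-(u ^ 2 * V / 2 : ℝ))
        = ((-(Real.exp (-(u ^ 2 * V / 2)) - 1 - -(u ^ 2 * V / 2)) : ℝ) : ℂ) := by
      push_cast; ring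
    rw [he, Complex.norm_real, Real.norm_eq_abs, abs_neg]
    refine h.trans ?_
    -- The error must stay linear in `V` to be summable to `σ ^ 2`, so only one factor `u ^ 2 * V`
    -- is traded for `(|u| * C) ^ 2 ≤ |u| * C`.
    have h1 : u ^ 2 * V * (u ^ 2 * V) ≤ u ^ 2 * V * (|u| * C) ^ 2 := by gcongr
    have h2 : (|u| * C) ^ 2 ≤ |u| * C := by nlinarith [mul_nonneg (abs_nonneg u) hC0]
    have h3 : u ^ 2 * V * (|u| * C) ^ 2 ≤ u ^ 2 * V * (|u| * C) := by gcongr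
    have h4 : u ^ 2 * V * (|u| * C) = |u| ^ 3 * C * V := by rw [← sq_abs u]; ring
    have h5 : 0 ≤ |u| ^ 3 * C * V := by positivity
    nlinarith
  calc _ ≤ _ := norm_sub_le_norm_sub_add_norm_sub _ (1 - (u ^ 2 * V / 2 : ℝ) : ℂ) _
    _ ≤ 2 * |u| ^ 3 * C * V := by linarith

/-- **Central limit theorem for triangular arrays** of independent, centred, uniformly bounded
random variables whose total variance tends to infinity. -/
theorem tendstoInDistribution_sum_of_bounded {Ω : ℕ → Type*} [∀ n, MeasurableSpace (Ω n)]
    (P : (n : ℕ) → Measure (Ω n)) [∀ n, IsProbabilityMeasure (P n)]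
    (X : (n : ℕ) → Fin n → Ω n → ℝ) (hX : ∀ n i, AEMeasurable (X n i) (P n))
    (hindep : ∀ n, iIndepFun (X n) (P n)) (h0 : ∀ n i, ∫ ω, X n i ω ∂(P n) = 0)
    {C : ℝ} (hC : ∀ n i, ∀ᵐ ω ∂(P n), |X n i ω| ≤ C) (σ : ℕ → ℝ)
    (hσ : ∀ n, σ n = Real.sqrt (∑ i, variance (X n i) (P n))) (hσ_top : Tendsto σ atTop atTop) :
    TendstoInDistribution (fun n ω => 1 / σ n * ∑ i, X n i ω) atTop (id : ℝ → ℝ) P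
      (gaussianReal 0 1) where
  forall_aemeasurable n := (Finset.aemeasurable_fun_sum _ fun i _ => hX n i).const_mul _
  tendsto := by
    refine ProbabilityMeasure.tendsto_iff_tendsto_charFun.2 fun t => ?_
    have hlim : Tendsto (fun n => 2 * |t| ^ 3 * C * (σ n)⁻¹) atTop (nhds 0) := by
      simpa using hσ_top.inv_tendsto_atTop.const_mul (2 * |t| ^ 3 * C)
    have hsmall : Tendsto (fun n => |t| * C * (σ n)⁻¹) atTop (nhds 0) := by
      simpa using hσ_top.inv_tendsto_atTop.const_mul (|t| * C)
    rw [tendsto_iff_norm_sub_tendsto_zero]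
    refine squeeze_zero' (.of_forall fun n => norm_nonneg _) ?_ hlim
    filter_upwards [hsmall.eventually (eventually_le_nhds zero_lt_one), hσ_top.eventually_gt_atTop 0]
      with n hn hpos
    have hu : |1 / σ n * t| = |t| * (σ n)⁻¹ := by
      rw [abs_mul, one_div, abs_of_pos (inv_pos.2 hpos), mul_comm]
    have hsq : σ n ^ 2 = ∑ i, variance (X n i) (P n) := by
      rw [hσ, Real.sq_sqrt (Finset.sum_nonneg fun i _ => variance_nonneg _ _)]
    have hlim_eq : charFun ((gaussianReal 0 1).map id) t
        = ∏ i, Complex.exp (-((1 / σ n * t) ^ 2 * variance (X n i) (P n) / 2 : ℝ)) := by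
      rw [Measure.map_id, charFun_gaussianReal, ← Complex.exp_sum]
      congr 1
      rw [Finset.sum_neg_distrib, ← Complex.ofReal_sum, ← Finset.sum_div, ← Finset.mul_sum, ← hsq,
        show (1 / σ n * t) ^ 2 * σ n ^ 2 = t ^ 2 by field_simp]
      simp
    have : ∀ i, IsProbabilityMeasure ((P n).map (X n i)) := fun i =>
      Measure.isProbabilityMeasure_map (hX n i)
    simp only [ProbabilityMeasure.coe_mk]
    rw [hlim_eq, charFun_map_mul_comp (Finset.aemeasurable_fun_sum _ fun i _ => hX n i),
      (hindep n).charFun_map_fun_sum_eq_prod (hX n), Finset.prod_apply]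
    calc _ ≤ ∑ i, ‖charFun ((P n).map (X n i)) (1 / σ n * t) -
          Complex.exp (-((1 / σ n * t) ^ 2 * variance (X n i) (P n) / 2 : ℝ))‖ := by
          refine norm_prod_sub_prod_le_sum _ _ _ (fun i => norm_charFun_le_one _) fun i => ?_
          rw [← Complex.ofReal_neg, Complex.norm_exp_ofReal, Real.exp_le_one_iff, neg_nonpos]
          have := variance_nonneg (X n i) (P n)
          positivity
      _ ≤ ∑ i, 2 * |1 / σ n * t| ^ 3 * C * variance (X n i) (P n) := by
          refine Finset.sum_le_sum fun i _ => norm_charFun_sub_exp_le (hX n i) (hC n i) (h0 n i) ?_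
          rw [hu]
          linarith
      _ = 2 * |t| ^ 3 * C * (σ n)⁻¹ := by
          -- The factor `σ ^ 2` cancels two of the three powers of `1 / σ`.
          rw [← Finset.mul_sum, ← hsq, hu]
          field_simp

end UniformQuantization

namespace UniformQuantization

/-! ### Bounds and unbiasedness for a single quantized entry -/

section Entry

variable {n : ℕ} {b : ℕ} {v : Fin n → ℝ}

theorem mem_bucket_self (b : ℕ) (i : Fin n) : i ∈ bucket b i := by simp [bucket]

theorem offset_le (b : ℕ) (v : Fin n → ℝ) (i : Fin n) : offset b v i ≤ v i :=
  Finset.inf'_le v (mem_bucket_self b i)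

theorem sub_offset_le_scale (b : ℕ) (v : Fin n → ℝ) (i : Fin n) :
    v i - offset b v i ≤ scale b v i :=
  sub_le_sub_right (Finset.le_sup' v (mem_bucket_self b i)) _

theorem scale_nonneg (b : ℕ) (v : Fin n → ℝ) (i : Fin n) : 0 ≤ scale b v i :=
  (sub_nonneg.2 (offset_le b v i)).trans (sub_offset_le_scale b v i)

theorem scaled_nonneg (b : ℕ) (v : Fin n → ℝ) (i : Fin n) : 0 ≤ scaled b v i :=
  div_nonneg (sub_nonneg.2 (offset_le b v i)) (scale_nonneg b v i)

theorem scaled_le_one (b : ℕ) (v : Fin n → ℝ) (i : Fin n) : scaled b v i ≤ 1 :=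
  div_le_one_of_le₀ (sub_offset_le_scale b v i) (scale_nonneg b v i)

theorem scale_mul_scaled_add_offset (b : ℕ) (v : Fin n → ℝ) (i : Fin n) :
    scale b v i * scaled b v i + offset b v i = v i := by
  rw [scaled, mul_div_cancel_of_imp', sub_add_cancel]
  -- If the scale vanishes, the entry equals the offset, so the convention `x / 0 = 0` does no harm.
  intro h
  exact le_antisymm (h ▸ sub_offset_le_scale b v i) (sub_nonneg.2 (offset_le b v i))

variable {M : ℝ}

theorem abs_offset_le (hv : ∀ i, |v i| ≤ M) (i : Fin n) : |offset b v i| ≤ M := by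
  obtain ⟨j, -, hj⟩ := Finset.exists_mem_eq_inf' (bucket_nonempty b i) v
  rw [offset, hj]
  exact hv j

theorem scale_le (hv : ∀ i, |v i| ≤ M) (i : Fin n) : scale b v i ≤ 2 * M := by
  obtain ⟨j, -, hj⟩ := Finset.exists_mem_eq_inf' (bucket_nonempty b i) v
  obtain ⟨k, -, hk⟩ := Finset.exists_mem_eq_sup' (bucket_nonempty b i) v
  rw [scale, hj, hk]
  linarith [(abs_le.1 (hv j)).1, (abs_le.1 (hv k)).2]

theorem abs_quantize_le {s : ℕ} (hs : 1 ≤ s) (hv : ∀ i, |v i| ≤ M) (i : Fin n) {ξ : ℝ}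
    (hξ : ξ = 1 ∨ ξ = 0) : |quantize s b v i ξ| ≤ 5 * M := by
  have hs1 : (1 : ℝ) ≤ s := by exact_mod_cast hs
  have hs0 : (0 : ℝ) < s := by linarith
  have hξ0 : 0 ≤ ξ := by rcases hξ with rfl | rfl <;> norm_num
  have hξ1 : ξ ≤ 1 := by rcases hξ with rfl | rfl <;> norm_num
  have hM : 0 ≤ M := (abs_nonneg _).trans (hv i)
  have hfl0 : (0 : ℝ) ≤ ⌊scaled b v i * s⌋ := by
    exact_mod_cast Int.floor_nonneg.2 (mul_nonneg (scaled_nonneg b v i) hs0.le)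
  have hfl1 : (⌊scaled b v i * s⌋ : ℝ) ≤ s :=
    (Int.floor_le _).trans (mul_le_of_le_one_left hs0.le (scaled_le_one b v i))
  have hu0 : 0 ≤ uniformQuant s (scaled b v i) ξ := by rw [uniformQuant]; positivity
  -- The bound is `2` rather than `1` because a scaled entry `1` with `ξ = 1` is not excluded here;
  -- any uniform bound will do.
  have hu2 : uniformQuant s (scaled b v i) ξ ≤ 2 := by
    rw [uniformQuant]
    linarith [(div_le_one hs0).2 hfl1, (div_le_one hs0).2 (hξ1.trans hs1)]
  have hq : scale b v i * uniformQuant s (scaled b v i) ξ ≤ 2 * M * 2 :=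
    mul_le_mul (scale_le hv i) hu2 hu0 (by positivity)
  calc |quantize s b v i ξ|
      ≤ |scale b v i * uniformQuant s (scaled b v i) ξ| + |offset b v i| := abs_add_le _ _
    _ ≤ 2 * M * 2 + M := by
        rw [abs_of_nonneg (mul_nonneg (scale_nonneg b v i) hu0)]
        exact add_le_add hq (abs_offset_le hv i)
    _ = 5 * M := by ring

theorem measurable_quantize (s b : ℕ) (v : Fin n → ℝ) (i : Fin n) :
    Measurable (quantize s b v i) := by
  unfold quantize uniformQuant
  fun_prop

variable {Ω : Type*} [MeasurableSpace Ω] {P : Measure Ω} {ξ : Ω → ℝ}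

theorem ae_eq_one_or_eq_zero {p : unitInterval}
    (hξ : HasLaw ξ (bernoulliMeasure (1 : ℝ) 0 p) P) : ∀ᵐ ω ∂P, ξ ω = 1 ∨ ξ ω = 0 := by
  have hm : MeasurableSet {y : ℝ | y = 1 ∨ y = 0} :=
    (measurableSet_singleton 1).union (measurableSet_singleton 0)
  refine ae_of_ae_map (p := fun y : ℝ => y = 1 ∨ y = 0) hξ.aemeasurable ?_
  rw [hξ.map_eq, ae_iff]
  exact bernoulliMeasure_apply_of_notMem_of_notMem p hm.compl (by simp) (by simp)

/-- Stochastic quantization is unbiased. -/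
theorem integral_quantize {s : ℕ} (hs : 1 ≤ s) (i : Fin n)
    (hξ : HasLaw ξ (bernoulliMeasure (1 : ℝ) 0 (roundProb s (scaled b v i))) P) :
    ∫ ω, quantize s b v i (ξ ω) ∂P = v i := by
  have hs0 : (s : ℝ) ≠ 0 := by positivity
  have h := hξ.integral_comp (measurable_quantize s b v i).aestronglyMeasurable
  rw [Function.comp_def] at h
  rw [h, integral_bernoulliMeasure]
  calc _ = scale b v i * scaled b v i + offset b v i := by
        simp only [quantize, uniformQuant, roundProb, smul_eq_mul]
        field_simp
        ring
    _ = v i := scale_mul_scaled_add_offset b v i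

end Entry

end UniformQuantization

open UniformQuantization

theorem mainTheorem2
    (s : ℕ) (hs : 1 ≤ s) (b : ℕ → ℕ)
    (v x : (n : ℕ) → Fin n → ℝ)
    (M : ℝ) (hv : ∀ n i, |v n i| ≤ M) (hx : ∀ n i, |x n i| ≤ M)
    {Ω : ℕ → Type*} [∀ n, MeasurableSpace (Ω n)]
    (P : (n : ℕ) → Measure (Ω n)) [∀ n, IsProbabilityMeasure (P n)]
    (ξ ζ : (n : ℕ) → Fin n → Ω n → ℝ)
    (hround : ∀ n, UniformQuantization.IsStochasticRounding (P n) s (b n) (v n) (x n) (ξ n) (ζ n))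
    (Qv Qx : (n : ℕ) → Fin n → Ω n → ℝ)
    (hQv : ∀ n i ω, Qv n i ω = UniformQuantization.quantize s (b n) (v n) i (ξ n i ω))
    (hQx : ∀ n i ω, Qx n i ω = UniformQuantization.quantize s (b n) (x n) i (ζ n i ω))
    (σ : ℕ → ℝ)
    (hσ : ∀ n, σ n = Real.sqrt (∑ i, variance (fun ω => Qv n i ω * Qx n i ω) (P n)))
    (hσ_top : Tendsto σ atTop atTop) :
    ∃ ε : (n : ℕ) → Ω n → ℝ,
      (∀ n ω, ∑ i, Qv n i ω * Qx n i ω = ∑ i, v n i * x n i + ε n ω) ∧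
      (∀ n, Integrable (ε n) (P n) ∧ ∫ ω, ε n ω ∂(P n) = 0) ∧
      TendstoInDistribution (fun n ω => 1 / σ n * ε n ω) atTop (id : ℝ → ℝ) P
        (gaussianReal 0 1) := by
  have hξ : ∀ n i, AEMeasurable (ξ n i) (P n) := fun n i => ((hround n).law_left i).aemeasurable
  have hζ : ∀ n i, AEMeasurable (ζ n i) (P n) := fun n i => ((hround n).law_right i).aemeasurable
  have hQvm : ∀ n i, AEMeasurable (Qv n i) (P n) := fun n i => by
    rw [funext (hQv n i)]
    exact (measurable_quantize _ _ _ _).comp_aemeasurable (hξ n i)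
  have hQxm : ∀ n i, AEMeasurable (Qx n i) (P n) := fun n i => by
    rw [funext (hQx n i)]
    exact (measurable_quantize _ _ _ _).comp_aemeasurable (hζ n i)
  have hQm : ∀ n i, AEMeasurable (fun ω => Qv n i ω * Qx n i ω) (P n) := fun n i =>
    (hQvm n i).mul (hQxm n i)
  have hbound : ∀ n i, ∀ᵐ ω ∂(P n), |Qv n i ω * Qx n i ω| ≤ 5 * M * (5 * M) := fun n i => by
    have hM : 0 ≤ M := (abs_nonneg _).trans (hv n i)
    filter_upwards [ae_eq_one_or_eq_zero ((hround n).law_left i),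
      ae_eq_one_or_eq_zero ((hround n).law_right i)] with ω h1 h2
    rw [hQv, hQx, abs_mul]
    exact mul_le_mul (abs_quantize_le hs (hv n) i h1)
      (abs_quantize_le hs (hx n) i h2) (abs_nonneg _) (by positivity)
  have hint : ∀ n i, Integrable (fun ω => Qv n i ω * Qx n i ω) (P n) := fun n i =>
    Integrable.of_bound (hQm n i).aestronglyMeasurable _ (hbound n i)
  have hmean : ∀ n i, ∫ ω, Qv n i ω * Qx n i ω ∂(P n) = v n i * x n i := fun n i => by
    have hind : IndepFun (ξ n i) (ζ n i) (P n) :=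
      (hround n).indep.indepFun (i := Sum.inl i) (j := Sum.inr i) Sum.inl_ne_inr
    have hindQ := hind.comp (measurable_quantize s (b n) (v n) i)
      (measurable_quantize s (b n) (x n) i)
    simp_rw [hQv, hQx]
    rw [← integral_quantize hs i ((hround n).law_left i),
      ← integral_quantize hs i ((hround n).law_right i)]
    refine hindQ.integral_fun_mul_eq_mul_integral ?_ ?_
    · exact (measurable_quantize _ _ _ _).comp_aemeasurable (hξ n i) |>.aestronglyMeasurable
    · exact (measurable_quantize _ _ _ _).comp_aemeasurable (hζ n i) |>.aestronglyMeasurable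
  have hintc : ∀ n i, Integrable (fun ω => Qv n i ω * Qx n i ω - v n i * x n i) (P n) :=
    fun n i => (hint n i).sub (integrable_const _)
  have hcentred : ∀ n i, ∫ ω, (Qv n i ω * Qx n i ω - v n i * x n i) ∂(P n) = 0 := fun n i => by
    rw [integral_sub (hint n i) (integrable_const _), hmean]
    simp
  refine ⟨fun n ω => ∑ i, (Qv n i ω * Qx n i ω - v n i * x n i), fun n ω => ?_, fun n => ⟨?_, ?_⟩,
    ?_⟩
  · simp
  · exact integrable_finsetSum _ fun i _ => hintc n i
  · refine (integral_finsetSum _ fun i _ => hintc n i).trans ?_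
    exact Finset.sum_eq_zero fun i _ => hcentred n i
  · refine tendstoInDistribution_sum_of_bounded P
      (fun n i ω => Qv n i ω * Qx n i ω - v n i * x n i) (fun n i => (hQm n i).sub_const _)
      (fun n => ?_) hcentred (C := 5 * M * (5 * M) + M * M) (fun n i => ?_) σ (fun n => ?_) hσ_top
    · have h := iIndepFun_comp_prodMk (hξ n) (hζ n) (hround n).indep
        (φ := fun i p => quantize s (b n) (v n) i p.1 *
          quantize s (b n) (x n) i p.2 - v n i * x n i)
        fun i => (((measurable_quantize s (b n) (v n) i).comp
          measurable_fst).mul ((measurable_quantize s (b n) (x n) i).comp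
          measurable_snd)).sub_const _
      simpa only [hQv, hQx] using h
    · have hM : 0 ≤ M := (abs_nonneg _).trans (hv n i)
      filter_upwards [hbound n i] with ω hω
      refine (abs_sub _ _).trans (add_le_add hω ?_)
      rw [abs_mul]
      exact mul_le_mul (hv n i) (hx n i) (abs_nonneg _) hM
    · rw [hσ]
      congr 1
      -- Centring leaves each variance unchanged.
      exact Finset.sum_congr rfl fun i _ =>
        (variance_sub_const (hQm n i).aestronglyMeasurable _).symm
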